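/- \textbf{Notation.} Let $\mathrm{M\ddot{o}b}=\mathrm{PSU}(1,1)$ act on the unit circle $S^1$ by fractional linear transformations, with rotations $R_\theta(z)=e^{i\theta}z$. An \emph{interval} is an open, nonempty, connected, nondense subset of $S^1$. Inner products are linear in the first variable. A \emph{Möbius-covariant net} $(\mathcal A,U,\Omega)$ on a Hilbert space $\mathcal H$ consists of a von Neumann algebra $\mathcal A(I)$ on $\mathcal H$ for each interval $I$, an SOT-continuous unitary representation $U$ of $\mathrm{M\ddot{o}b}$ on $\mathcal H$ and a nonzero vector $\Omega\in\mathcal H$ such that: $\mathcal A(I)\subseteq\mathcal A(J)$ if $I\subseteq J$; $\mathcal A(I)$ and $\mathcal A(J)$ commute if $I\cap J=\emptyset$; $U(\gamma)\Omega=\Omega$ and $U(\gamma)\mathcal A(I)U(\gamma)^*=\mathcal A(\gamma I)$; the generator $L_0$ of rotations, $U(R_\theta)=e^{i\theta L_0}$, is positive; $\Omega$ is, up to a scalar, the only $U$-invariant vector, and it is cyclic for $\bigvee_I\mathcal A(I)$. Let $\mathcal V(n)=\ker(L_0-n)$ for $n\in\mathbb Z_{\ge0}$, and let $\mathcal V=\bigoplus_{n\ge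 0}\mathcal V(n)$ be the space of finite-energy vectors (algebraic direct sum). An \emph{adjointable distribution} with domain $\mathcal V$ is a linear map $\varphi:C^\infty(S^1)\to\mathrm{Hom}(\mathcal V,\mathcal H)$, continuous for the topology of pointwise convergence on $\mathcal V$, for which there is a map $\varphi^\dagger$ of the same kind with $\langle\varphi(f)u,v\rangle=\langle u,\varphi^\dagger(\overline f)v\rangle$ for all $f\in C^\infty(S^1)$ and $u,v\in\mathcal V$. Let $\widehat{\mathcal V}$ be the space of antilinear functionals on $\mathcal V$; it contains $\mathcal H$ through $\xi\mapsto\langle\xi,\cdot\,\rangle$. Extend $\varphi(f)$ to a map $\mathcal H\to\widehat{\mathcal V}$ by $\langle\varphi(f)\xi,v\rangle=\langle\xi,\varphi^\dagger(\overline f)v\rangle$ for $v\in\mathcal V$. Such a $\varphi$ is \emph{Möbius-covariant} if there is an integer $d\ge0$ such that for all $\gamma\in\mathrm{M\ddot{o}b}$, $f\in C^\infty(S^1)$ and $u\in\mathcal V$ we have $\varphi(f)U(\gamma)^*u\in\mathcal H$ and $U(\gamma)\varphi(f)U(\gamma)^*u=\varphi(\beta_d(\gamma)f)u$, where $(\beta_d(\gamma)f)(z)=X_\gamma(\gamma^{-1}z)^{d-1}f(\gamma^{-1}z)$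 and $X_\gamma(e^{i\theta})=-i\frac{d}{d\theta}\log\gamma(e^{i\theta})$. It is \emph{affiliated with $\mathcal A$} if, whenever $I$ is an interval and $\operatorname{supp}f\subseteq I$, there is a closed densely defined operator $X$ affiliated with $\mathcal A(I)$ such that $\varphi(f)\subseteq X\subseteq\varphi^\dagger(\overline f)^*$. \textbf{Theorem.} Let $(\mathcal A,U,\Omega)$ be a Möbius-covariant net, and let $\mathcal F$ be the family of all Möbius-covariant adjointable distributions with domain $\mathcal V$ that are affiliated with $\mathcal A$. Then $\mathcal V$ is dense in $\mathcal H$, and $\mathcal F$ satisfies all axioms of a quasi-Wightman field theory except possibly cyclicity of the vacuum. That is: \begin{enumerate} \item each $\varphi\in\mathcal F$ is adjointable and Möbius-covariant with respect to the SOT-continuous representation $U$; \item if $\varphi\in\mathcal F$, then $\varphi^\dagger\in\mathcal F$; \item if $\varphi,\psi\in\mathcal F$ and $f,g\in C^\infty(S^1)$ have disjoint supports, then $\varphi(f)\psi(g)=\psi(g)\varphi(f)$ as maps $\mathcal V\to\widehat{\mathcal V}$; \item the generator $L_0$ of rotations is positive; \item $\Omega$ is a nonzero $U$-invariant vector in $\mathcal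 V$, and every $U$-invariant vector in $\mathcal V$ is a scalar multiple of $\Omega$. \end{enumerate} -/

import Mathlib

open scoped Manifold ContDiff ComplexConjugate InnerProductSpace

namespace ChiralCFT

noncomputable section

/-! ## The Möbius group `PSU(1,1)` -/

/-- `SU(1,1)`: complex matrices `(a, b; conj b, conj a)` with `|a|² - |b|² = 1`. -/
def SU11 : Subgroup (Matrix.SpecialLinearGroup (Fin 2) ℂ) where
  carrier := {g | g.1 1 0 = conj (g.1 0 1) ∧ g.1 1 1 = conj (g.1 0 0)}
  one_mem' := by simp
  mul_mem' := by
    rintro g h ⟨hg1, hg2⟩ ⟨hh1, hh2⟩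
    simp only [Set.mem_ofPred_eq, Matrix.SpecialLinearGroup.coe_mul, Matrix.mul_apply,
      Fin.sum_univ_two, map_add, map_mul, hg1, hg2, hh1, hh2, Complex.conj_conj]
    constructor <;> ring
  inv_mem' := by
    rintro g ⟨hg1, hg2⟩
    simp only [Set.mem_ofPred_eq, Matrix.SpecialLinearGroup.coe_inv, Matrix.adjugate_fin_two]
    simp [hg1, hg2]

/-- The subgroup `{1, -1}` of `SU(1,1)`. -/
def SU11.pmOne : Subgroup SU11 where
  carrier := {g | g.1.1 = 1 ∨ g.1.1 = -1}
  one_mem' := by simp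
  mul_mem' := by
    rintro g h (hg | hg) (hh | hh) <;> simp [hg, hh]
  inv_mem' := by
    rintro g (hg | hg)
    · left; simp [hg]
    · right
      simp only [InvMemClass.coe_inv, Matrix.SpecialLinearGroup.coe_inv, hg]
      ext i j
      fin_cases i <;> fin_cases j <;> simp [Matrix.adjugate_fin_two]

instance SU11.pmOne_normal : SU11.pmOne.Normal where
  conj_mem := by
    intro n hn g
    have hgi : g.1.1 * (g⁻¹).1.1 = 1 := by
      exact congrArg (fun x : SU11 => x.1.1) (mul_inv_cancel g)
    have hexp : (g * n * g⁻¹).1.1 = g.1.1 * n.1.1 * (g⁻¹).1.1 := by simp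
    rcases hn with hn | hn
    · left; rw [hexp, hn, mul_one, hgi]
    · right; rw [hexp, hn, mul_neg, mul_one, neg_mul, hgi]

/-- The Möbius group `PSU(1,1) = SU(1,1) / {1, -1}`, a topological group with the
quotient topology. -/
abbrev Mob : Type := SU11 ⧸ SU11.pmOne

theorem SU11.normSq_sub (g : SU11) :
    Complex.normSq (g.1.1 0 0) - Complex.normSq (g.1.1 0 1) = 1 := by
  have h := g.1.2
  rw [Matrix.det_fin_two, g.2.1, g.2.2, Complex.mul_conj, Complex.mul_conj] at h
  exact_mod_cast h

theorem SU11.num_eq (g : SU11) (z : Circle) :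
    g.1.1 0 0 * z + g.1.1 0 1 = z * conj (g.1.1 1 0 * z + g.1.1 1 1) := by
  have hz : conj (z : ℂ) * z = 1 := by
    rw [← Circle.coe_inv_eq_conj, ← Circle.coe_mul, inv_mul_cancel, Circle.coe_one]
  rw [g.2.1, g.2.2, map_add, map_mul, Complex.conj_conj, Complex.conj_conj]
  linear_combination (-g.1.1 0 1) * hz

theorem SU11.denom_ne_zero (g : SU11) (z : Circle) : g.1.1 1 0 * z + g.1.1 1 1 ≠ 0 := by
  intro h
  have h1 : ‖g.1.1 0 1‖ = ‖g.1.1 0 0‖ := by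
    have h2 : g.1.1 1 0 * (z : ℂ) = - g.1.1 1 1 := eq_neg_of_add_eq_zero_left h
    have h3 := congrArg norm h2
    rwa [norm_mul, Circle.norm_coe, mul_one, norm_neg, g.2.1, g.2.2, RCLike.norm_conj,
      RCLike.norm_conj] at h3
  have := SU11.normSq_sub g
  rw [Complex.normSq_eq_norm_sq, Complex.normSq_eq_norm_sq, h1] at this
  exact zero_ne_one ((sub_self _).symm.trans this)

/-- The fractional linear transformation `z ↦ (a z + b) / (conj b z + conj a)` of the circle. -/
def SU11.flt (g : SU11) (z : Circle) : Circle :=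
  ⟨(g.1.1 0 0 * z + g.1.1 0 1) / (g.1.1 1 0 * z + g.1.1 1 1), by
    have h := SU11.denom_ne_zero g z
    refine mem_sphere_zero_iff_norm.2 ?_
    rw [norm_div, SU11.num_eq, norm_mul, Circle.norm_coe, one_mul, RCLike.norm_conj,
      div_self (norm_ne_zero_iff.2 h)]⟩

theorem SU11.coe_flt (g : SU11) (z : Circle) :
    (SU11.flt g z : ℂ) = (g.1.1 0 0 * z + g.1.1 0 1) / (g.1.1 1 0 * z + g.1.1 1 1) := rfl

instance SU11.instMulAction : MulAction SU11 Circle where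
  smul g z := SU11.flt g z
  one_smul z := by
    apply Circle.ext
    change (SU11.flt 1 z : ℂ) = z
    simp [SU11.coe_flt]
  mul_smul g h z := by
    apply Circle.ext
    change (SU11.flt (g * h) z : ℂ) = (SU11.flt g (SU11.flt h z) : ℂ)
    have h1 := SU11.denom_ne_zero h z
    have h2 := SU11.denom_ne_zero g (SU11.flt h z)
    have h3 := SU11.denom_ne_zero (g * h) z
    rw [SU11.coe_flt] at h2
    rw [SU11.coe_flt g, SU11.coe_flt h, SU11.coe_flt (g * h), div_eq_div_iff h3 h2]
    simp only [Subgroup.coe_mul, Matrix.SpecialLinearGroup.coe_mul, Matrix.mul_apply,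
      Fin.sum_univ_two]
    field_simp
    ring

/-- The action of the Möbius group on the circle, as a homomorphism into permutations. -/
def Mob.toPerm : Mob →* Equiv.Perm Circle :=
  QuotientGroup.lift SU11.pmOne (MulAction.toPermHom SU11 Circle) (by
    intro g hg
    refine Equiv.ext fun z => Circle.ext ?_
    change (SU11.flt g z : ℂ) = z
    rw [SU11.coe_flt]
    rcases hg with hg | hg <;> simp [hg])

instance Mob.instMulAction : MulAction Mob Circle := MulAction.compHom Circle Mob.toPerm

theorem Mob.mk_smul (g : SU11) (z : Circle) : (QuotientGroup.mk g : Mob) • z = SU11.flt g z := rfl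

/-- The element `diag (e^{iθ/2}, e^{-iθ/2})` of `SU(1,1)`. -/
def SU11.rot (θ : ℝ) : SU11 :=
  ⟨⟨!![(Circle.exp (θ / 2) : ℂ), 0; 0, ((Circle.exp (θ / 2))⁻¹ : Circle)], by
    rw [Matrix.det_fin_two_of, ← Circle.coe_mul, mul_inv_cancel]; simp⟩, by
    constructor
    · simp
    · exact Circle.coe_inv_eq_conj _⟩

/-- The rotation `R_θ : z ↦ e^{iθ} z`. -/
def Mob.rot (θ : ℝ) : Mob := QuotientGroup.mk (SU11.rot θ)

theorem Mob.rot_smul (θ : ℝ) (z : Circle) : Mob.rot θ • z = Circle.exp θ * z := by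
  apply Circle.ext
  rw [Mob.rot, Mob.mk_smul, SU11.coe_flt]
  have : Circle.exp θ = Circle.exp (θ / 2) * Circle.exp (θ / 2) := by
    rw [← Circle.exp_add, add_halves]
  simp only [SU11.rot, this, Circle.coe_mul, Circle.coe_inv]
  simp
  ring

/-! ## Smooth functions on the circle -/

/-- `C^∞(S¹)`: smooth complex-valued functions on the circle. -/
def SmoothFn : Submodule ℂ (Circle → ℂ) where
  carrier := {f | ContMDiff (𝓡 1) 𝓘(ℝ, ℂ) ∞ f}
  zero_mem' := contMDiff_const
  add_mem' := fun hf hg => ContMDiff.add hf hg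
  smul_mem' := fun c _ hf =>
    (((ContinuousLinearMap.mul ℝ ℂ c).contDiff (n := ∞)).comp_contMDiff hf :)

instance : CoeFun SmoothFn (fun _ => Circle → ℂ) := ⟨fun f => f.1⟩

/-- The Fréchet topology of `C^∞(S¹)`: uniform convergence of all derivatives with respect to
the angle `θ`. (Not an instance: Lean would find the topology of pointwise convergence too.) -/
abbrev SmoothFn.frechetTopology : TopologicalSpace SmoothFn :=
  ⨅ k : ℕ, TopologicalSpace.induced
    (fun f : SmoothFn =>
      UniformFun.ofFun (iteratedDeriv k (fun θ : ℝ => f (Circle.exp θ)))) inferInstance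

/-- The complex conjugate of a smooth function. -/
def conjFn (f : SmoothFn) : SmoothFn :=
  ⟨fun z => conj (f z), (Complex.conjCLE.contDiff (n := ∞)).comp_contMDiff f.2⟩

theorem conjFn_conjFn (f : SmoothFn) : conjFn (conjFn f) = f :=
  Subtype.ext (funext fun z => Complex.conj_conj (f z))

/-- `X_γ(e^{iθ}) = -i d/dθ log γ(e^{iθ})`, by means of the logarithmic derivative. -/
def Mob.X (γ : Mob) (z : Circle) : ℂ :=
  -Complex.I * logDeriv (fun t : ℝ => ((γ • (Circle.exp t * z) : Circle) : ℂ)) 0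

theorem Mob.X_mk (g : SU11) (z : Circle) :
    Mob.X (QuotientGroup.mk g) z =
      ((g.1.1 1 0 * z + g.1.1 1 1) * conj (g.1.1 1 0 * z + g.1.1 1 1))⁻¹ := by
  have hd := SU11.denom_ne_zero g z
  have hn := SU11.num_eq g z
  have hdet := g.1.2
  rw [Matrix.det_fin_two] at hdet
  have hcd : conj (g.1.1 1 0 * z + g.1.1 1 1) ≠ 0 := (map_ne_zero _).2 hd
  have he : HasDerivAt (fun t : ℝ => ((Circle.exp t * z : Circle) : ℂ)) (Complex.I * z) 0 := by
    have h1 : HasDerivAt (fun t : ℝ => Complex.exp (t * Complex.I)) Complex.I 0 := by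
      have h2 := (Complex.ofRealCLM.hasDerivAt (x := 0)).mul_const Complex.I
      simpa using h2.cexp
    simpa using h1.mul_const (z : ℂ)
  have h0 : ((Circle.exp 0 * z : Circle) : ℂ) = z := by simp
  have hD := ((he.const_mul (g.1.1 0 0)).add_const (g.1.1 0 1)).fun_div
    ((he.const_mul (g.1.1 1 0)).add_const (g.1.1 1 1)) (by rw [h0]; exact hd)
  simp only [h0] at hD
  rw [Mob.X, logDeriv_apply]
  simp only [Mob.mk_smul, SU11.coe_flt]
  rw [hD.deriv, h0]
  have hzz : (z : ℂ) ≠ 0 := Circle.coe_ne_zero z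
  rw [show g.1.1 0 0 * (Complex.I * z) * (g.1.1 1 0 * z + g.1.1 1 1) -
      (g.1.1 0 0 * z + g.1.1 0 1) * (g.1.1 1 0 * (Complex.I * z)) = Complex.I * z by
    linear_combination (Complex.I * z) * hdet, hn]
  generalize conj (g.1.1 1 0 * z + g.1.1 1 1) = e at hcd
  generalize g.1.1 1 0 * z + g.1.1 1 1 = d at hd
  field_simp
  simp

theorem Circle.contMDiff_coe :
    ContMDiff (𝓡 1) 𝓘(ℝ, ℂ) ∞ (fun z : Circle => (z : ℂ)) := by
  have := finrank_real_complex_fact'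
  exact contMDiff_coe_sphere

theorem Mob.contMDiff_smul (γ : Mob) :
    ContMDiff (𝓡 1) (𝓡 1) ∞ (fun z : Circle => γ • z) := by
  have := finrank_real_complex_fact'
  induction γ using QuotientGroup.induction_on with
  | H g =>
  have h : ContMDiff (𝓡 1) 𝓘(ℝ, ℂ) ∞ (fun z : Circle => (SU11.flt g z : ℂ)) := by
    intro z
    have hd := SU11.denom_ne_zero g z
    have h1 : ContDiffAt ℝ ∞ (fun w : ℂ =>
        (g.1.1 0 0 * w + g.1.1 0 1) / (g.1.1 1 0 * w + g.1.1 1 1)) z := by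
      have hlin : ∀ a b : ℂ, ContDiffAt ℝ ∞ (fun w : ℂ => a * w + b) z := fun a b =>
        (contDiffAt_const.mul contDiffAt_id).add contDiffAt_const
      simp only [div_eq_mul_inv]
      exact (hlin _ _).mul ((hlin _ _).inv hd)
    simp only [SU11.coe_flt]
    exact ContDiffAt.comp_contMDiffAt h1 (Circle.contMDiff_coe z)
  exact ContMDiff.codRestrict_sphere h (fun z => (SU11.flt g z).2)

theorem Mob.contMDiff_X_zpow (γ : Mob) (n : ℤ) :
    ContMDiff (𝓡 1) 𝓘(ℝ, ℂ) ∞ (fun z : Circle => Mob.X γ z ^ n) := by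
  induction γ using QuotientGroup.induction_on with
  | H g =>
  intro z
  simp only [Mob.X_mk]
  have hd := SU11.denom_ne_zero g z
  have hne := mul_ne_zero hd ((map_ne_zero conj).2 hd)
  have h1 : ContDiffAt ℝ ∞ (fun w : ℂ => g.1.1 1 0 * w + g.1.1 1 1) z :=
    (contDiffAt_const.mul contDiffAt_id).add contDiffAt_const
  have h2 : ContDiffAt ℝ ∞ (fun w : ℂ => (g.1.1 1 0 * w + g.1.1 1 1) *
      conj (g.1.1 1 0 * w + g.1.1 1 1)) z :=
    h1.mul (Complex.conjCLE.contDiff.contDiffAt.comp (z : ℂ) h1)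
  have h3 : ContDiffAt ℝ ∞ (fun w : ℂ => (((g.1.1 1 0 * w + g.1.1 1 1) *
      conj (g.1.1 1 0 * w + g.1.1 1 1))⁻¹) ^ n) z := by
    cases n with
    | ofNat m => exact (h2.inv hne).pow m
    | negSucc m =>
      simp only [zpow_negSucc, inv_pow, inv_inv]
      exact h2.pow (m + 1)
  exact ContDiffAt.comp_contMDiffAt h3 (Circle.contMDiff_coe z)

/-- `(β_d(γ) f)(z) = X_γ(γ⁻¹ z)^(d-1) f(γ⁻¹ z)`. -/
def Mob.beta (d : ℕ) (γ : Mob) (f : SmoothFn) : SmoothFn :=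
  ⟨fun z => Mob.X γ (γ⁻¹ • z) ^ ((d : ℤ) - 1) * f (γ⁻¹ • z), by
    have h1 := (Mob.contMDiff_X_zpow γ ((d : ℤ) - 1)).comp (Mob.contMDiff_smul γ⁻¹)
    have h2 := (f.2 : ContMDiff (𝓡 1) 𝓘(ℝ, ℂ) ∞ f.1).comp (Mob.contMDiff_smul γ⁻¹)
    exact (contDiff_mul (𝕜 := ℝ) (n := ∞)).comp_contMDiff (h1.prodMk_space h2)⟩

/-! ## Intervals of the circle -/

/-- Open, nonempty, connected, nondense subsets of the circle. -/
structure Interval where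
  carrier : Set Circle
  isOpen : IsOpen carrier
  isConnected : IsConnected carrier
  not_dense : ¬ Dense carrier

/-- The image `γ I` of an interval. -/
def Interval.map (γ : Mob) (I : Interval) : Interval where
  carrier := (fun z => γ • z) '' I.carrier
  isOpen := by
    rw [Set.image_eq_preimage_of_inverse (g := fun z => γ⁻¹ • z)
      (fun z => inv_smul_smul γ z) (fun z => smul_inv_smul γ z)]
    exact I.isOpen.preimage (Mob.contMDiff_smul γ⁻¹).continuous
  isConnected := I.isConnected.image _ (Mob.contMDiff_smul γ).continuous.continuousOn
  not_dense := by
    intro h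
    apply I.not_dense
    have h2 := (Function.Surjective.denseRange (f := fun z : Circle => γ⁻¹ • z)
      (fun z => ⟨γ • z, inv_smul_smul γ z⟩)).dense_image
        (Mob.contMDiff_smul γ⁻¹).continuous h
    simpa [Set.image_image] using h2

/-! ## Unitary representations of the Möbius group and finite-energy vectors -/

section Hilbert

variable {H : Type*} [NormedAddCommGroup H] [InnerProductSpace ℂ H] [CompleteSpace H]

/-- `U γ` as a bounded operator. -/
abbrev op (U : Mob →* unitary (H →L[ℂ] H)) (γ : Mob) : H →L[ℂ] H := (U γ : H →L[ℂ] H)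

/-- Continuity in the strong operator topology. -/
def SOTContinuous (U : Mob →* unitary (H →L[ℂ] H)) : Prop :=
  ∀ ξ : H, Continuous fun γ => op U γ ξ

/-- The generator of rotations `L₀`, `U(R_θ) = e^{iθ L₀}`: the operator
`L₀ v = -i d/dθ U(R_θ) v` at `θ = 0`, on the vectors for which this derivative exists. -/
def L0 (U : Mob →* unitary (H →L[ℂ] H)) : H →ₗ.[ℂ] H where
  domain :=
    { carrier := {v | DifferentiableAt ℝ (fun θ : ℝ => op U (Mob.rot θ) v) 0}
      zero_mem' := by simp
      add_mem' := by
        intro v w hv hw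
        exact (DifferentiableAt.add hv hw).congr_of_eventuallyEq
          (.of_forall fun θ => map_add (op U (Mob.rot θ)) v w)
      smul_mem' := by
        intro c v hv
        exact (DifferentiableAt.const_smul hv c).congr_of_eventuallyEq
          (.of_forall fun θ => map_smul (op U (Mob.rot θ)) c v) }
  toFun :=
    { toFun := fun v => -Complex.I • deriv (fun θ : ℝ => op U (Mob.rot θ) (v : H)) 0
      map_add' := by
        intro v w
        have := deriv_add (𝕜 := ℝ) v.2 w.2
        rw [← smul_add, ← this]
        congr 2
        ext θ
        simp
      map_smul' := by
        intro c v
        have := deriv_const_smul (𝕜 := ℝ) c v.2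
        rw [RingHom.id_apply, smul_comm, ← this]
        congr 2
        ext θ
        simp }

/-- The spectrum condition: `L₀` is a positive operator. -/
def SpectrumCondition (U : Mob →* unitary (H →L[ℂ] H)) : Prop :=
  ∀ v : (L0 U).domain, 0 ≤ (inner ℂ (v : H) (L0 U v)).re

/-- The weight space `V(n) = ker (L₀ - n)`. -/
def weightSpace (U : Mob →* unitary (H →L[ℂ] H)) (n : ℕ) : Submodule ℂ H where
  carrier := {v | ∃ h : v ∈ (L0 U).domain, L0 U ⟨v, h⟩ = (n : ℂ) • v}
  zero_mem' := ⟨Submodule.zero_mem _, by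
    have : (⟨0, Submodule.zero_mem _⟩ : (L0 U).domain) = 0 := rfl
    rw [this, LinearPMap.map_zero, smul_zero]⟩
  add_mem' := by
    rintro v w ⟨hv, hv2⟩ ⟨hw, hw2⟩
    refine ⟨Submodule.add_mem _ hv hw, ?_⟩
    have : (⟨v + w, Submodule.add_mem _ hv hw⟩ : (L0 U).domain) = ⟨v, hv⟩ + ⟨w, hw⟩ := rfl
    rw [this, LinearPMap.map_add, hv2, hw2, smul_add]
  smul_mem' := by
    rintro c v ⟨hv, hv2⟩
    refine ⟨Submodule.smul_mem _ c hv, ?_⟩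
    have : (⟨c • v, Submodule.smul_mem _ c hv⟩ : (L0 U).domain) = c • ⟨v, hv⟩ := rfl
    rw [this, LinearPMap.map_smul, hv2, smul_comm]

/-- The space `V` of finite-energy vectors, the algebraic (direct) sum of the `V(n)`. -/
def finiteEnergy (U : Mob →* unitary (H →L[ℂ] H)) : Submodule ℂ H :=
  ⨆ n : ℕ, weightSpace U n

/-- `ξ` is invariant under `U`. -/
def IsInvariant (U : Mob →* unitary (H →L[ℂ] H)) (ξ : H) : Prop :=
  ∀ γ, op U γ ξ = ξ

/-! ## Operator-valued distributions -/

/-- An operator-valued distribution on the circle with domain `D` (a dense subspace): a linear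
map from `C^∞(S¹)` to linear maps `D → H`, continuous for pointwise convergence on `D`. -/
structure OpDistribution (D : Submodule ℂ H) where
  toLin : SmoothFn →ₗ[ℂ] (D →ₗ[ℂ] H)
  continuous_apply : ∀ u : D, @Continuous SmoothFn H SmoothFn.frechetTopology inferInstance fun f => toLin f u

/-- `φ` and `ψ` are adjoint to each other: `⟨φ(f) u, v⟩ = ⟨u, ψ(conj f) v⟩` for `u, v ∈ D`.
(Inner products of Mathlib are linear in the second variable.) -/
def OpDistribution.IsAdjointPair {D : Submodule ℂ H} (φ ψ : OpDistribution D) : Prop :=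
  ∀ (f : SmoothFn) (u v : D),
    inner ℂ (v : H) (φ.toLin f u) = inner ℂ (ψ.toLin (conjFn f) v) (u : H)

/-- An adjointable distribution `φ` on `D`, together with its adjoint `φ†`, which is determined
by `φ` if `D` is dense (see `AdjDistribution.ext_of_dense`). -/
structure AdjDistribution (D : Submodule ℂ H) where
  dist : OpDistribution D
  adj : OpDistribution D
  isAdjointPair : dist.IsAdjointPair adj

namespace AdjDistribution

variable {D : Submodule ℂ H}

/-- The smeared field `φ(f) : D → H`. -/
abbrev smear (φ : AdjDistribution D) (f : SmoothFn) : D →ₗ[ℂ] H := φ.dist.toLin f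

/-- `φ(f)` as an unbounded operator on `H` with domain `D`. -/
def unbdd (φ : AdjDistribution D) (f : SmoothFn) : H →ₗ.[ℂ] H := ⟨D, φ.smear f⟩

/-- The involution `φ ↦ φ†`. -/
def dagger (φ : AdjDistribution D) : AdjDistribution D where
  dist := φ.adj
  adj := φ.dist
  isAdjointPair := by
    intro f u v
    have h := φ.isAdjointPair (conjFn f) v u
    rw [conjFn_conjFn] at h
    rw [← inner_conj_symm, ← h, inner_conj_symm]

theorem ext_of_dense (hD : Dense (D : Set H)) {φ ψ : AdjDistribution D}
    (h : ∀ f u, φ.smear f u = ψ.smear f u) : φ = ψ := by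
  have key : φ.adj.toLin = ψ.adj.toLin := by
    ext f v
    refine hD.eq_of_inner_left (𝕜 := ℂ) fun u hu => ?_
    have h1 := φ.isAdjointPair (conjFn f) ⟨u, hu⟩ v
    have h2 := ψ.isAdjointPair (conjFn f) ⟨u, hu⟩ v
    rw [conjFn_conjFn] at h1 h2
    rw [← h1, ← h2, show φ.dist.toLin (conjFn f) ⟨u, hu⟩ = ψ.dist.toLin (conjFn f) ⟨u, hu⟩ from h _ _]
  have key2 : φ.dist.toLin = ψ.dist.toLin := by
    ext f u
    exact h f u
  obtain ⟨⟨a, ha⟩, ⟨b, hb⟩, hab⟩ := φ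
  obtain ⟨⟨c, hc⟩, ⟨d, hd⟩, hcd⟩ := ψ
  obtain rfl : b = d := key
  obtain rfl : a = c := key2
  rfl

end AdjDistribution

/-- The algebraic completion of `D`, realized as the space of antilinear functionals on `D`. For
the finite-energy vectors `V = ⨁ V(n)` with finite-dimensional `V(n)` this is `∏ V(n)`, the
sequence `(ξ_n)` being the functional `v ↦ ∑ ⟨v_n, ξ_n⟩`. -/
abbrev Hat (D : Submodule ℂ H) : Type _ := D →ₗ⋆[ℂ] ℂ

/-- The canonical map `H → Hat D`, injective if `D` is dense. -/
def toHat (D : Submodule ℂ H) (ξ : H) : Hat D := ((innerₛₗ ℂ).flip ξ).comp D.subtype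

/-- The extension of `φ(f)` to a map `H → Hat D`, by `⟨φ(f) ξ, v⟩ = ⟨ξ, φ†(conj f) v⟩`. -/
def AdjDistribution.extend {D : Submodule ℂ H} (φ : AdjDistribution D) (f : SmoothFn) (ξ : H) :
    Hat D :=
  ((innerₛₗ ℂ).flip ξ).comp (φ.dagger.smear (conjFn f))

theorem AdjDistribution.extend_coe {D : Submodule ℂ H} (φ : AdjDistribution D) (f : SmoothFn)
    (u : D) : φ.extend f u = toHat D (φ.smear f u) :=
  LinearMap.ext fun v => (φ.isAdjointPair f u v).symm

/-- Möbius covariance of degree `d` in the Wightman sense: for `u ∈ V`, the vector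
`φ(f) U(γ)^* u` of `Hat V` lies in `H`, and `U(γ) φ(f) U(γ)^* u = φ(β_d(γ) f) u`. -/
def IsMobCovariant (U : Mob →* unitary (H →L[ℂ] H)) (d : ℕ)
    (φ : AdjDistribution (finiteEnergy U)) : Prop :=
  ∀ (γ : Mob) (f : SmoothFn) (u : finiteEnergy U),
    ∃ ξ : H, φ.extend f (star (op U γ) u) = toHat (finiteEnergy U) ξ ∧
      op U γ ξ = φ.smear (Mob.beta d γ f) u

/-! ## Möbius-covariant nets and affiliated fields -/

/-- The von Neumann algebra generated by the algebras `A I`, as a set (the double commutant of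
their union). -/
def generated (A : Interval → VonNeumannAlgebra H) : Set (H →L[ℂ] H) :=
  Set.centralizer (Set.centralizer (⋃ I, (A I : Set (H →L[ℂ] H))))

/-- `(A, U, Ω)` is a Möbius-covariant net on the circle. -/
structure IsMobCovariantNet (A : Interval → VonNeumannAlgebra H)
    (U : Mob →* unitary (H →L[ℂ] H)) (Ω : H) : Prop where
  sot_continuous : SOTContinuous U
  isotony : ∀ I J : Interval, I.carrier ⊆ J.carrier → A I ≤ A J
  locality : ∀ I J : Interval, Disjoint I.carrier J.carrier →
    ∀ x ∈ A I, ∀ y ∈ A J, x * y = y * x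
  vacuum_invariant : IsInvariant U Ω
  covariance : ∀ (γ : Mob) (I : Interval),
    (fun x => op U γ * x * star (op U γ)) '' (A I : Set (H →L[ℂ] H)) = A (I.map γ)
  spectrum : SpectrumCondition U
  vacuum_ne_zero : Ω ≠ 0
  vacuum_unique : ∀ ξ : H, IsInvariant U ξ → ∃ c : ℂ, ξ = c • Ω
  vacuum_cyclic : Dense {ξ : H | ∃ x ∈ generated A, x Ω = ξ}

/-- The unbounded operator `X` is affiliated with the von Neumann algebra `M`: it is closed,
densely defined, and `T X ⊆ X T` for every `T` in the commutant of `M`. -/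
def IsAffiliated (X : H →ₗ.[ℂ] H) (M : VonNeumannAlgebra H) : Prop :=
  Dense (X.domain : Set H) ∧ X.IsClosed ∧
    ∀ T ∈ M.commutant, ∀ x : X.domain, ∃ h : T x ∈ X.domain, X ⟨T x, h⟩ = T (X x)

/-- An adjointable distribution `φ` with domain `D` is affiliated with `A` if whenever
`supp f ⊆ I` there is `φ(f) ⊆ X ⊆ φ†(conj f)^*` with `X` affiliated with `A I`. -/
def AdjDistribution.IsAffiliatedWithNet {D : Submodule ℂ H} (φ : AdjDistribution D)
    (A : Interval → VonNeumannAlgebra H) : Prop :=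
  ∀ (I : Interval) (f : SmoothFn), tsupport f ⊆ I.carrier →
    ∃ X : H →ₗ.[ℂ] H, φ.unbdd f ≤ X ∧ X ≤ (φ.dagger.unbdd (conjFn f)).adjoint ∧ IsAffiliated X (A I)

/-- The family of all Möbius-covariant (of some degree) adjointable distributions with domain the
finite-energy vectors that are affiliated with `A`. -/
def affiliatedFields (A : Interval → VonNeumannAlgebra H) (U : Mob →* unitary (H →L[ℂ] H)) :
    Set (AdjDistribution (finiteEnergy U)) :=
  {φ | (∃ d : ℕ, IsMobCovariant U d φ) ∧ φ.IsAffiliatedWithNet A}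

/-! ## Quasi-Wightman field theories -/

/-- The axioms of a (Möbius-covariant) quasi-Wightman field theory `(F, U, Ω)` on the
finite-energy vectors `V` of `U`, for a family `F` of adjointable distributions with domain `V`,
without the requirement that `V` is spanned by the vectors `φ₁(z^n₁) ⋯ φ_k(z^n_k) Ω`. -/
structure IsQuasiWightmanExceptCyclicity (U : Mob →* unitary (H →L[ℂ] H)) (Ω : H)
    (F : Set (AdjDistribution (finiteEnergy U))) : Prop where
  dense : Dense (finiteEnergy U : Set H)
  sot_continuous : SOTContinuous U
  mob_covariance : ∀ φ ∈ F, ∃ d : ℕ, IsMobCovariant U d φ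
  dagger_mem : ∀ φ ∈ F, φ.dagger ∈ F
  locality : ∀ φ ∈ F, ∀ ψ ∈ F, ∀ f g : SmoothFn, Disjoint (tsupport f) (tsupport g) →
    ∀ u : finiteEnergy U, φ.extend f (ψ.smear g u) = ψ.extend g (φ.smear f u)
  spectrum : SpectrumCondition U
  vacuum_mem : Ω ∈ finiteEnergy U
  vacuum_ne_zero : Ω ≠ 0
  vacuum_invariant : IsInvariant U Ω
  vacuum_unique : ∀ ξ ∈ finiteEnergy U, IsInvariant U ξ → ∃ c : ℂ, ξ = c • Ω

end Hilbert

end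

end ChiralCFT

/-! The content of the theorem lies in the density of the finite-energy vectors, in the stability of
the family of affiliated fields under `φ ↦ φ†`, and in locality.

Density (`dense_finiteEnergy`). The rotations act periodically, so the Fourier coefficients of an
orbit `θ ↦ U(R_θ) ξ` are eigenvectors of all `U(R_θ)`, hence of `L₀`, with integral eigenvalues, and
positivity of `L₀` leaves only the eigenvalues `n ≥ 0`. If `ξ` is orthogonal to all these
eigenvectors, the continuous function `θ ↦ ⟨ξ, U(R_θ) ξ⟩` has vanishing Fourier coefficients, so
it vanishes, in particular at `θ = 0`.

Adjoints. Covariance of `φ` is an identity between matrix elements (`isMobCovariant_iff`); replacing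
`γ` by `γ⁻¹` and `f` by `conj (β_d(γ) f)` turns it into the identity for `φ†`, as `X_γ` is real and
`X_{γ⁻¹} ∘ γ = 1 / X_γ`. If `φ(conj f) ⊆ X ⊆ φ†(f)†` with `X` affiliated with `A(I)`, then
`φ†(f) ⊆ X† ⊆ φ(conj f)†`, and `X†` is affiliated with `A(I)` too.

Locality (`AdjDistribution.extend_smear_comm`). By partitions of unity it is enough to treat test
functions supported in disjoint intervals `I` and `J`. Let `X` and `Y` be the closed extensions of
`φ(f)` and `ψ(g)`, affiliated with `A(I)` and `A(J)`. The projection onto the graph of `t X`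
commutes with `T ⊕ T` for `T` in the commutant of `A(I)`, so its matrix entries lie in `A(I)`;
one of them is `t X (1 + t² X† X)⁻¹`. Dividing it by `t` and letting `t → 0` gives bounded `B ∈ A(I)` with
`B u → X u` and `B† v → X† v` (`IsAffiliated.exists_tendsto`). Each `B` commutes with `Y`, so
`⟨B† v, Y u⟩ = ⟨v, Y B u⟩ = ⟨Y† v, B u⟩`, and the limit is `⟨X† v, Y u⟩ = ⟨Y† v, X u⟩`. -/

namespace ChiralCFT

noncomputable section

open Filter Topology

/-! ### Bounded approximations of a closed operator -/

section ClosedOperators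

/-- For nonexpansive maps, pointwise convergence to zero on a dense set extends to all points. -/
theorem tendsto_zero_of_dense {H K : Type*} [NormedAddCommGroup H] [NormedAddCommGroup K]
    {q : ℕ → H → K} (hq : ∀ n x y, ‖q n x - q n y‖ ≤ ‖x - y‖) {D : Set H} (hD : Dense D)
    (h : ∀ x ∈ D, Tendsto (fun n => q n x) atTop (𝓝 0)) (x : H) :
    Tendsto (fun n => q n x) atTop (𝓝 0) := by
  rw [Metric.tendsto_atTop]
  intro ε hε
  obtain ⟨y, hyD, hy⟩ := Metric.dense_iff.1 hD x (ε / 2) (half_pos hε)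
  obtain ⟨N, hN⟩ := Metric.tendsto_atTop.1 (h y hy) (ε / 2) (half_pos hε)
  refine ⟨N, fun n hn => ?_⟩
  have h1 := hN n hn
  rw [Metric.mem_ball, dist_comm, dist_eq_norm] at hyD
  rw [dist_zero_right] at h1 ⊢
  calc ‖q n x‖ = ‖(q n x - q n y) + q n y‖ := by rw [sub_add_cancel]
    _ ≤ ‖q n x - q n y‖ + ‖q n y‖ := norm_add_le _ _
    _ < ε := by linarith [hq n x y]

variable {H : Type*} [NormedAddCommGroup H] [InnerProductSpace ℂ H]

/-- The graph of `t X` for `t ≠ 0`, as a subspace of the Hilbert space `H ⊕ H`. The factor `t`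
is put on the argument of `X`, so that no division by `t` occurs. -/
def scaledGraph (X : H →ₗ.[ℂ] H) (t : ℂ) : Submodule ℂ (WithLp 2 (H × H)) :=
  X.graph.comap (LinearMap.prod (t • (WithLp.fstL 2 ℂ H H).toLinearMap)
    (WithLp.sndL 2 ℂ H H).toLinearMap)

theorem mem_scaledGraph {X : H →ₗ.[ℂ] H} {t : ℂ} {k : WithLp 2 (H × H)} :
    k ∈ scaledGraph X t ↔ (t • k.fst, k.snd) ∈ X.graph := Iff.rfl

theorem isClosed_scaledGraph {X : H →ₗ.[ℂ] H} (hX : X.IsClosed) (t : ℂ) :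
    IsClosed (scaledGraph X t : Set (WithLp 2 (H × H))) := by
  have hX' : IsClosed (X.graph : Set (H × H)) := hX
  exact hX'.preimage (((WithLp.fstL 2 ℂ H H).continuous.const_smul t).prodMk
    (WithLp.sndL 2 ℂ H H).continuous)

/-- The map `ξ ↦ (ξ, 0)` into the Hilbert space `H ⊕ H`. -/
def inlL (H : Type*) [NormedAddCommGroup H] [InnerProductSpace ℂ H] : H →L[ℂ] WithLp 2 (H × H) :=
  (WithLp.prodContinuousLinearEquiv 2 ℂ H H).symm ∘L ContinuousLinearMap.inl ℂ H H

theorem inlL_apply (ξ : H) : inlL H ξ = WithLp.toLp 2 (ξ, 0) := rfl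

/-- If `S` and its adjoint `S†` leave a closed subspace invariant, then `S` commutes with the
orthogonal projection onto it. -/
theorem starProjection_map_of_invariant {K : Type*} [NormedAddCommGroup K] [InnerProductSpace ℂ K]
    (G : Submodule ℂ K) [G.HasOrthogonalProjection] {S S' : K → K}
    (hS : ∀ x y, S (x - y) = S x - S y)
    (hadj : ∀ x y, inner ℂ (S x) y = inner ℂ x (S' y))
    (h : ∀ k ∈ G, S k ∈ G) (h' : ∀ k ∈ G, S' k ∈ G) (k : K) :
    G.starProjection (S k) = S (G.starProjection k) := by
  refine Submodule.eq_starProjection_of_mem_of_inner_eq_zero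
    (h _ (Submodule.starProjection_apply_mem _ _)) fun w hw => ?_
  rw [← hS, hadj]
  exact Submodule.starProjection_inner_eq_zero _ _ (h' w hw)

variable [CompleteSpace H]

/-- A closed operator `X` affiliated with `M` is approximated by bounded operators in `M`, namely
by `B = X (1 + t² X† X)⁻¹` as `t → 0`: `B u → X u` for `u` in the domain of `X`, and
`B† v → X† v` for `v` in the domain of `X†` (the vectors `v` for which a `w` as in `hw` exists). -/
theorem IsAffiliated.exists_tendsto {X : H →ₗ.[ℂ] H} {M : VonNeumannAlgebra H}
    (hX : IsAffiliated X M)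
    (hadj : Dense {v : H | ∃ w : H, ∀ x : X.domain, inner ℂ w (x : H) = inner ℂ v (X x)})
    (u : X.domain) {v w : H} (hw : ∀ x : X.domain, inner ℂ w (x : H) = inner ℂ v (X x)) :
    ∃ B : ℕ → H →L[ℂ] H, (∀ n, B n ∈ M) ∧ Tendsto (fun n => B n u) atTop (𝓝 (X u)) ∧
      Tendsto (fun n => star (B n) v) atTop (𝓝 w) := by
  obtain ⟨hdense, hclosed, hcomm⟩ := hX
  let t : ℕ → ℂ := fun n => ((1 / ((n : ℝ) + 1) : ℝ) : ℂ)
  have ht0 : ∀ n, t n ≠ 0 := fun n => Complex.ofReal_ne_zero.2 (by positivity)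
  have htlim : Tendsto (fun n => ‖t n‖) atTop (𝓝 0) := by
    have h1 := tendsto_one_div_add_atTop_nhds_zero_nat (𝕜 := ℝ)
    have h2 := h1.norm
    simpa only [norm_zero, t, Complex.norm_real] using h2
  let G : ℕ → Submodule ℂ (WithLp 2 (H × H)) := fun n => scaledGraph X (t n)
  have : ∀ n, CompleteSpace (G n) := fun n => (isClosed_scaledGraph hclosed (t n)).completeSpace_coe
  -- The projection of `(ξ, 0)` to the graph of `t X` is
  -- `((1 + t² X† X)⁻¹ ξ, t X (1 + t² X† X)⁻¹ ξ)`.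
  let P : ∀ n, WithLp 2 (H × H) →L[ℂ] WithLp 2 (H × H) := fun n => (G n).starProjection
  have hPmem : ∀ n k, (t n • (P n k).fst, (P n k).snd) ∈ X.graph := fun n k =>
    mem_scaledGraph.1 (Submodule.starProjection_apply_mem (G n) k)
  have hPnorm : ∀ n k, ‖P n k‖ ≤ ‖k‖ := fun n k => Submodule.norm_starProjection_apply_le _ k
  have hfst : ∀ k : WithLp 2 (H × H), ‖k.fst‖ ≤ ‖k‖ := fun k => WithLp.norm_fst_le _ k
  have hsnd : ∀ k : WithLp 2 (H × H), ‖k.snd‖ ≤ ‖k‖ := fun k => WithLp.norm_snd_le _ k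
  have hPfix : ∀ n k, k ∈ G n → P n k = k := fun n k hk =>
    Submodule.starProjection_eq_self_iff.2 hk
  let B : ℕ → H →L[ℂ] H := fun n => (t n)⁻¹ • ((WithLp.sndL 2 ℂ H H) ∘L (P n) ∘L (inlL H))
  have hB : ∀ n ξ, B n ξ = (t n)⁻¹ • (P n (WithLp.toLp 2 (ξ, 0))).snd := fun n ξ => rfl
  refine ⟨B, fun n => ?_, ?_, ?_⟩
  · rw [← VonNeumannAlgebra.commutant_commutant M, VonNeumannAlgebra.mem_commutant_iff]
    intro T hT
    have hG : ∀ T' ∈ M.commutant, ∀ k ∈ G n, WithLp.toLp 2 (T' k.fst, T' k.snd) ∈ G n := by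
      intro T' hT' k hk
      obtain ⟨y, hy1, hy2⟩ := (LinearPMap.mem_graph_iff X).1 (mem_scaledGraph.1 hk)
      obtain ⟨h3, h4⟩ := hcomm T' hT' y
      refine mem_scaledGraph.2 ((LinearPMap.mem_graph_iff X).2 ⟨⟨_, h3⟩, ?_, ?_⟩)
      · exact (congrArg T' hy1).trans (T'.map_smul _ _)
      · exact h4.trans (congrArg T' hy2)
    have hPT := starProjection_map_of_invariant (G n)
      (S := fun k => WithLp.toLp 2 (T k.fst, T k.snd))
      (S' := fun k => WithLp.toLp 2 (star T k.fst, star T k.snd))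
      (fun x y => by simp [← WithLp.toLp_sub])
      (fun x y => by
        simp [ContinuousLinearMap.star_eq_adjoint, ContinuousLinearMap.adjoint_inner_right])
      (hG T hT) (hG _ (star_mem hT))
    ext ξ
    have h5 := congrArg (fun k : WithLp 2 (H × H) => k.snd) (hPT (WithLp.toLp 2 (ξ, 0)))
    have h6 : WithLp.toLp 2 (T ξ, T 0) = WithLp.toLp 2 (T ξ, (0 : H)) := by rw [map_zero]
    change T (B n ξ) = B n (T ξ)
    rw [hB, hB, map_smul]
    rw [← h6]
    exact congrArg _ h5.symm
  · have h1 : ∀ n, B n u = X u - (P n (WithLp.toLp 2 (0, X u))).snd := by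
      intro n
      have h2 : WithLp.toLp 2 ((u : H), t n • X u) ∈ G n :=
        mem_scaledGraph.2 ((LinearPMap.mem_graph_iff X).2 ⟨t n • u, rfl, X.map_smul _ _⟩)
      have h3 : WithLp.toLp 2 ((u : H), (0 : H)) =
          WithLp.toLp 2 ((u : H), t n • X u) - t n • WithLp.toLp 2 ((0 : H), X u) := by
        rw [← WithLp.toLp_smul, ← WithLp.toLp_sub]; simp
      rw [hB, h3, map_sub, map_smul, hPfix n _ h2, WithLp.sub_snd, WithLp.smul_snd, smul_sub,
        inv_smul_smul₀ (ht0 n)]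
      exact congrArg (· - _) (inv_smul_smul₀ (ht0 n) (X u))
    have h4 : Tendsto (fun n => (P n (WithLp.toLp 2 (0, X u))).snd) atTop (𝓝 0) := by
      refine tendsto_zero_of_dense (q := fun n η => (P n (WithLp.toLp 2 ((0 : H), η))).snd)
        (fun n x y => ?_) hadj ?_ (X u)
      · rw [← WithLp.sub_snd, ← map_sub, ← WithLp.toLp_sub]
        refine (hsnd _).trans ((hPnorm _ _).trans ?_)
        simp
      · rintro η ⟨ζ, hζ⟩
        refine squeeze_zero_norm (a := fun n => ‖t n‖ * ‖ζ‖) (fun n => ?_)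
          (by simpa using htlim.mul_const ‖ζ‖)
        -- `(-t X† η, η)` is orthogonal to the graph of `t X`.
        have h5 : P n (WithLp.toLp 2 (-(conj (t n) • ζ), η)) = 0 := by
          refine (Submodule.starProjection_apply_eq_zero_iff (G n)).2
            ((Submodule.mem_orthogonal' _ _).2 fun k hk => ?_)
          obtain ⟨y, hy1, hy2⟩ := (LinearPMap.mem_graph_iff X).1 (mem_scaledGraph.1 hk)
          have h6 := hζ y
          rw [hy1, hy2] at h6
          simp only at h6
          rw [inner_smul_right] at h6
          rw [WithLp.prod_inner_apply]
          simp only [inner_neg_left, inner_smul_left, Complex.conj_conj]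
          exact (congrArg (_ + ·) h6.symm).trans (neg_add_cancel _)
        have h7 : WithLp.toLp 2 ((0 : H), η) =
            WithLp.toLp 2 (-(conj (t n) • ζ), η) + inlL H (conj (t n) • ζ) := by
          rw [inlL_apply, ← WithLp.toLp_add]; simp
        rw [h7, map_add, h5, zero_add, inlL_apply]
        refine (hsnd _).trans ((hPnorm _ _).trans ?_)
        simp [norm_smul]
    simp only [h1]
    simpa using h4.const_sub (X u)
  · have h1 : ∀ n, star (B n) v = (P n (WithLp.toLp 2 (w, 0))).fst := by
      intro n
      refine ext_inner_right ℂ fun ξ => ?_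
      obtain ⟨y, hy1, hy2⟩ := (LinearPMap.mem_graph_iff X).1 (hPmem n (WithLp.toLp 2 (ξ, 0)))
      have h6 := hw y
      rw [hy1, hy2] at h6
      simp only at h6
      have h7 := Submodule.inner_starProjection_left_eq_right (G n) (WithLp.toLp 2 (w, 0))
        (WithLp.toLp 2 (ξ, 0))
      rw [WithLp.prod_inner_apply, WithLp.prod_inner_apply] at h7
      simp only [inner_zero_left, inner_zero_right, add_zero] at h7
      rw [ContinuousLinearMap.star_eq_adjoint, ContinuousLinearMap.adjoint_inner_left, hB,
        inner_smul_right, ← h6, inner_smul_right, inv_mul_cancel_left₀ (ht0 n)]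
      exact h7.symm
    have h2 := tendsto_zero_of_dense
      (q := fun n η => η - (P n (WithLp.toLp 2 (η, (0 : H)))).fst) (fun n x y => ?_) hdense ?_ w
    · simp only [h1]
      simpa using h2.const_sub w
    · have h3 : x - (P n (WithLp.toLp 2 (x, 0))).fst - (y - (P n (WithLp.toLp 2 (y, 0))).fst) =
          ((G n)ᗮ.starProjection (inlL H (x - y))).fst := by
        rw [Submodule.starProjection_orthogonal_val, inlL_apply, WithLp.sub_fst]
        have : WithLp.toLp 2 (x - y, (0 : H)) = WithLp.toLp 2 (x, 0) - WithLp.toLp 2 (y, 0) := by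
          rw [← WithLp.toLp_sub]; simp
        rw [this, map_sub, WithLp.sub_fst, WithLp.sub_fst]
        exact sub_sub_sub_comm _ _ _ _
      rw [h3]
      refine (hfst _).trans ((Submodule.norm_starProjection_apply_le _ _).trans ?_)
      simp [inlL_apply]
    · intro x hx
      refine squeeze_zero_norm (a := fun n => ‖t n‖ * ‖X ⟨x, hx⟩‖) (fun n => ?_)
        (by simpa using htlim.mul_const ‖X ⟨x, hx⟩‖)
      have h2 : WithLp.toLp 2 (x, t n • X ⟨x, hx⟩) ∈ G n :=
        mem_scaledGraph.2 ((LinearPMap.mem_graph_iff X).2 ⟨t n • ⟨x, hx⟩, rfl, X.map_smul _ _⟩)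
      have h3 : WithLp.toLp 2 (x, (0 : H)) =
          WithLp.toLp 2 (x, t n • X ⟨x, hx⟩) - WithLp.toLp 2 (0, t n • X ⟨x, hx⟩) := by
        rw [← WithLp.toLp_sub]; simp
      rw [h3, map_sub, hPfix n _ h2, WithLp.sub_fst]
      change ‖x - (x - _)‖ ≤ _
      rw [sub_sub_cancel]
      refine (hfst _).trans ((hPnorm _ _).trans ?_)
      simp [norm_smul]

end ClosedOperators

/-! ### Density of the finite-energy vectors -/

section FiniteEnergy

theorem Mob.rot_add (s t : ℝ) : Mob.rot (s + t) = Mob.rot s * Mob.rot t := by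
  rw [Mob.rot, Mob.rot, Mob.rot, ← QuotientGroup.mk_mul]
  congr 1
  apply Subtype.ext
  apply Subtype.ext
  change (SU11.rot (s + t)).1.1 = (SU11.rot s).1.1 * (SU11.rot t).1.1
  have h : Circle.exp ((s + t) / 2) = Circle.exp (s / 2) * Circle.exp (t / 2) := by
    rw [← Circle.exp_add, add_div]
  ext i j
  fin_cases i <;> fin_cases j <;>
    simp [SU11.rot, h, Matrix.mul_apply, mul_comm]

theorem Mob.rot_zero : Mob.rot 0 = 1 := by
  have h := Mob.rot_add 0 0
  rwa [add_zero, left_eq_mul] at h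

theorem Mob.rot_two_pi : Mob.rot (2 * Real.pi) = 1 := by
  rw [Mob.rot, QuotientGroup.eq_one_iff]
  -- Half-angles make the representative in `SU(1,1)` equal to `-1`.
  right
  have h : Circle.exp (2 * Real.pi / 2) = -1 := by
    rw [mul_div_cancel_left₀ _ two_ne_zero]
    apply Circle.ext
    simp
  ext i j
  fin_cases i <;> fin_cases j <;> simp only [SU11.rot, h] <;> simp

theorem Mob.continuous_rot : Continuous Mob.rot := by
  refine continuous_quotient_mk'.comp ?_
  refine Continuous.subtype_mk (Continuous.subtype_mk ?_ _) _
  refine continuous_matrix fun i j => ?_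
  fin_cases i <;> fin_cases j <;> simp [← Complex.exp_neg] <;> fun_prop

variable {H : Type*} [NormedAddCommGroup H] [InnerProductSpace ℂ H] [CompleteSpace H]
  {U : Mob →* unitary (H →L[ℂ] H)}

theorem op_mul (γ δ : Mob) (ξ : H) : op U (γ * δ) ξ = op U γ (op U δ ξ) := by
  simp [op]

theorem op_one (ξ : H) : op U 1 ξ = ξ := by
  simp [op]

/-- The orbit `θ ↦ U(R_θ) ξ` of a vector under the rotations, as a function on `ℝ / 2πℤ`. -/
def rotOrbit (U : Mob →* unitary (H →L[ℂ] H)) (ξ : H) : AddCircle (2 * Real.pi) → H :=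
  Function.Periodic.lift (f := fun θ : ℝ => op U (Mob.rot θ) ξ) (c := 2 * Real.pi) fun θ => by
    simp only [Mob.rot_add, Mob.rot_two_pi, mul_one]

theorem rotOrbit_coe (ξ : H) (θ : ℝ) : rotOrbit U ξ θ = op U (Mob.rot θ) ξ := rfl

theorem rotOrbit_add (ξ : H) (θ : ℝ) (x : AddCircle (2 * Real.pi)) :
    rotOrbit U ξ (x + θ) = op U (Mob.rot θ) (rotOrbit U ξ x) := by
  induction x using QuotientAddGroup.induction_on with
  | H s =>
  rw [← AddCircle.coe_add, rotOrbit_coe, rotOrbit_coe, add_comm, Mob.rot_add, op_mul]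

theorem continuous_rotOrbit (hU : SOTContinuous U) (ξ : H) : Continuous (rotOrbit U ξ) :=
  continuous_quot_lift _ ((hU ξ).comp Mob.continuous_rot)

instance fact_two_pi_pos : Fact (0 < 2 * Real.pi) := ⟨Real.two_pi_pos⟩

/-- The `n`-th Fourier coefficient of the orbit of `ξ` is an eigenvector of the rotations. -/
theorem op_rot_fourierCoeff (ξ : H) (n : ℤ) (θ : ℝ) :
    op U (Mob.rot θ) (fourierCoeff (rotOrbit U ξ) n) =
      Complex.exp (n * θ * Complex.I) • fourierCoeff (rotOrbit U ξ) n := by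
  by_cases hi : MeasureTheory.Integrable
    (fun x => fourier (-n) x • rotOrbit U ξ x) (AddCircle.haarAddCircle (T := 2 * Real.pi))
  swap
  · rw [fourierCoeff, MeasureTheory.integral_undef hi, map_zero, smul_zero]
  have h1 : ∀ x, op U (Mob.rot θ) (fourier (-n) x • rotOrbit U ξ x) =
      Complex.exp (n * θ * Complex.I) •
        (fourier (-n) (x + (θ : AddCircle (2 * Real.pi))) •
          rotOrbit U ξ (x + (θ : AddCircle (2 * Real.pi)))) := by
    intro x
    rw [map_smul, rotOrbit_add, smul_smul]
    congr 1
    have h2 : fourier (-n) (x + (θ : AddCircle (2 * Real.pi))) =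
        fourier (-n) x * Complex.exp (-(n * θ * Complex.I)) := by
      rw [fourier_apply, smul_add, AddCircle.toCircle_add, Circle.coe_mul, ← fourier_apply,
        ← fourier_apply, fourier_coe_apply]
      congr 2
      have : (Real.pi : ℂ) ≠ 0 := Complex.ofReal_ne_zero.2 Real.pi_ne_zero
      push_cast
      field_simp
    rw [h2, mul_left_comm, ← Complex.exp_add, add_neg_cancel, Complex.exp_zero, mul_one]
  rw [fourierCoeff, ← ContinuousLinearMap.integral_comp_comm _ hi]
  simp only [h1]
  rw [MeasureTheory.integral_smul]
  congr 1
  exact MeasureTheory.integral_add_right_eq_self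
    (fun x => fourier (-n) x • rotOrbit U ξ x) (θ : AddCircle (2 * Real.pi))

theorem mem_L0_domain_of_rot {ξ : H} {n : ℤ}
    (h : ∀ θ : ℝ, op U (Mob.rot θ) ξ = Complex.exp (n * θ * Complex.I) • ξ) :
    ∃ hξ : ξ ∈ (L0 U).domain, L0 U ⟨ξ, hξ⟩ = (n : ℂ) • ξ := by
  have h1 : HasDerivAt (fun θ : ℝ => Complex.exp (n * θ * Complex.I)) (n * Complex.I) 0 := by
    have h2 := ((Complex.ofRealCLM.hasDerivAt (x := 0)).const_mul (n : ℂ)).mul_const Complex.I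
    simpa using h2.cexp
  have h3 : HasDerivAt (fun θ : ℝ => op U (Mob.rot θ) ξ) ((n * Complex.I : ℂ) • ξ) 0 := by
    simp only [h]
    exact h1.smul_const ξ
  refine ⟨h3.differentiableAt, ?_⟩
  change -Complex.I • deriv (fun θ : ℝ => op U (Mob.rot θ) ξ) 0 = _
  rw [h3.deriv, smul_smul]
  congr 1
  linear_combination (-n : ℂ) * Complex.I_mul_I

/-- The spectrum condition kills the eigenvectors of the rotations of negative weight. -/
theorem mem_finiteEnergy_of_rot (hU : SpectrumCondition U) {ξ : H} {n : ℤ}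
    (h : ∀ θ : ℝ, op U (Mob.rot θ) ξ = Complex.exp (n * θ * Complex.I) • ξ) :
    ξ ∈ finiteEnergy U := by
  obtain ⟨hξ, hL⟩ := mem_L0_domain_of_rot h
  rcases le_or_gt 0 n with hn | hn
  · lift n to ℕ using hn
    exact Submodule.mem_iSup_of_mem n ⟨hξ, by simpa using hL⟩
  · have h1 := hU ⟨ξ, hξ⟩
    rw [hL, inner_smul_right, inner_self_eq_norm_sq_to_K] at h1
    have h2 : 0 ≤ (n : ℝ) * ‖ξ‖ ^ 2 := by
      have h3 : ((n : ℂ) * ((‖ξ‖ : ℂ)) ^ 2) = (((n : ℝ) * ‖ξ‖ ^ 2 : ℝ) : ℂ) := by push_cast; rfl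
      have h4 := h1
      change 0 ≤ ((n : ℂ) * ((‖ξ‖ : ℂ)) ^ 2).re at h4
      rwa [h3, Complex.ofReal_re] at h4
    have h5 : (n : ℝ) < 0 := by exact_mod_cast hn
    have h6 : ‖ξ‖ ^ 2 = 0 := le_antisymm (nonpos_of_mul_nonneg_right h2 h5) (sq_nonneg _)
    rw [norm_eq_zero.1 (pow_eq_zero_iff two_ne_zero |>.1 h6)]
    exact Submodule.zero_mem _

/-- Finite-energy vectors are dense: a vector orthogonal to all Fourier coefficients of an orbit
`θ ↦ U(R_θ) ξ` is orthogonal to the orbit. -/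
theorem dense_finiteEnergy (hU : SOTContinuous U) (hspec : SpectrumCondition U) :
    Dense (finiteEnergy U : Set H) := by
  rw [Submodule.dense_iff_topologicalClosure_eq_top, Submodule.topologicalClosure_eq_top_iff,
    Submodule.eq_bot_iff]
  intro w hw
  let f : C(AddCircle (2 * Real.pi), ℂ) :=
    ⟨fun x => inner ℂ w (rotOrbit U w x), continuous_const.inner (continuous_rotOrbit hU w)⟩
  have hf : fourierCoeff f = 0 := by
    funext n
    have h1 : fourierCoeff f n = inner ℂ w (fourierCoeff (rotOrbit U w) n) := by
      have hi : MeasureTheory.Integrable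
          (fun x => fourier (-n) x • rotOrbit U w x)
          (AddCircle.haarAddCircle (T := 2 * Real.pi)) :=
        ((map_continuous (fourier (-n))).smul
          (continuous_rotOrbit hU w)).integrable_of_hasCompactSupport
          (HasCompactSupport.of_compactSpace _)
      rw [fourierCoeff, fourierCoeff, ← integral_inner hi]
      refine MeasureTheory.integral_congr_ae (.of_forall fun x => ?_)
      simp only [inner_smul_right, smul_eq_mul]
      rfl
    rw [h1]
    exact Submodule.inner_left_of_mem_orthogonal
      (mem_finiteEnergy_of_rot hspec (op_rot_fourierCoeff w n)) hw
  have h2 := has_pointwise_sum_fourier_series_of_summable (f := f)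
    (by rw [hf]; exact summable_zero) 0
  rw [hf] at h2
  simp only [Pi.zero_apply, zero_smul] at h2
  have h3 : f 0 = 0 := h2.unique hasSum_zero
  have h4 : f 0 = inner ℂ w w := by
    change inner ℂ w (rotOrbit U w ((0 : ℝ) : AddCircle (2 * Real.pi))) = _
    rw [rotOrbit_coe, Mob.rot_zero, op_one]
  exact inner_self_eq_zero.1 (h4.symm.trans h3)

end FiniteEnergy

/-! ### The adjoint of an affiliated field -/

section Adjoint

theorem Mob.conj_X (γ : Mob) (z : Circle) : conj (Mob.X γ z) = Mob.X γ z := by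
  induction γ using QuotientGroup.induction_on with
  | H g => rw [Mob.X_mk, map_inv₀, map_mul, Complex.conj_conj, mul_comm]

theorem Mob.X_inv_mul_X (γ : Mob) (z : Circle) : Mob.X γ⁻¹ (γ • z) * Mob.X γ z = 1 := by
  induction γ using QuotientGroup.induction_on with
  | H g =>
  have hd := SU11.denom_ne_zero g z
  have hdet := g.1.2
  rw [Matrix.det_fin_two] at hdet
  have h10 : (g⁻¹).1.1 1 0 = -g.1.1 1 0 := by
    simp [Matrix.SpecialLinearGroup.coe_inv, Matrix.adjugate_fin_two]
  have h11 : (g⁻¹).1.1 1 1 = g.1.1 0 0 := by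
    simp [Matrix.SpecialLinearGroup.coe_inv, Matrix.adjugate_fin_two]
  have h : (g⁻¹).1.1 1 0 * (SU11.flt g z : ℂ) + (g⁻¹).1.1 1 1 =
      (g.1.1 1 0 * z + g.1.1 1 1)⁻¹ := by
    rw [h10, h11, SU11.coe_flt]
    field_simp
    linear_combination hdet
  rw [← QuotientGroup.mk_inv, Mob.mk_smul, Mob.X_mk, Mob.X_mk, h, map_inv₀]
  have hcd := (map_ne_zero conj).2 hd
  field_simp

theorem Mob.beta_inv_conjFn_beta (d : ℕ) (γ : Mob) (f : SmoothFn) :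
    Mob.beta d γ⁻¹ (conjFn (Mob.beta d γ f)) = conjFn f := by
  refine Subtype.ext (funext fun z => ?_)
  change Mob.X γ⁻¹ (γ⁻¹⁻¹ • z) ^ ((d : ℤ) - 1) *
    conj (Mob.X γ (γ⁻¹ • γ⁻¹⁻¹ • z) ^ ((d : ℤ) - 1) * f (γ⁻¹ • γ⁻¹⁻¹ • z)) = conj (f z)
  rw [inv_inv, inv_smul_smul, map_mul, map_zpow₀, Mob.conj_X, ← mul_assoc, ← mul_zpow,
    Mob.X_inv_mul_X, one_zpow, one_mul]

variable {H : Type*} [NormedAddCommGroup H] [InnerProductSpace ℂ H] [CompleteSpace H]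

theorem inner_star_op (U : Mob →* unitary (H →L[ℂ] H)) (γ : Mob) (ξ η : H) :
    inner ℂ ξ (star (op U γ) η) = inner ℂ (op U γ ξ) η := by
  rw [ContinuousLinearMap.star_eq_adjoint, ContinuousLinearMap.adjoint_inner_right]

theorem op_star_op (U : Mob →* unitary (H →L[ℂ] H)) (γ : Mob) (ξ : H) :
    op U γ (star (op U γ) ξ) = ξ := by
  have h := Unitary.mul_star_self_of_mem (U γ).2
  exact congrArg (fun T : H →L[ℂ] H => T ξ) h

theorem op_inv (U : Mob →* unitary (H →L[ℂ] H)) (γ : Mob) : op U γ⁻¹ = star (op U γ) := by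
  rw [op, map_inv]
  rfl

/-- Möbius covariance in terms of matrix elements. -/
theorem isMobCovariant_iff {U : Mob →* unitary (H →L[ℂ] H)} {d : ℕ}
    {φ : AdjDistribution (finiteEnergy U)} :
    IsMobCovariant U d φ ↔ ∀ (γ : Mob) (f : SmoothFn) (u v : finiteEnergy U),
      inner ℂ (φ.dagger.smear (conjFn f) v) (star (op U γ) (u : H)) =
        inner ℂ (op U γ (v : H)) (φ.smear (Mob.beta d γ f) u) := by
  constructor
  · intro h γ f u v
    obtain ⟨ξ, h1, h2⟩ := h γ f u
    rw [← h2]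
    refine (LinearMap.congr_fun h1 v).trans ?_
    change inner ℂ (v : H) ξ = _
    rw [← inner_star_op]
    exact congrArg (fun T : H →L[ℂ] H => inner ℂ (v : H) (T ξ))
      (Unitary.star_mul_self_of_mem (U γ).2).symm
  · intro h γ f u
    refine ⟨star (op U γ) (φ.smear (Mob.beta d γ f) u), LinearMap.ext fun v => ?_,
      op_star_op U γ _⟩
    refine (h γ f u v).trans ?_
    exact (inner_star_op U γ _ _).symm

theorem IsMobCovariant.dagger {U : Mob →* unitary (H →L[ℂ] H)} {d : ℕ}
    {φ : AdjDistribution (finiteEnergy U)} (h : IsMobCovariant U d φ) :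
    IsMobCovariant U d φ.dagger := by
  rw [isMobCovariant_iff] at h ⊢
  intro γ f u v
  -- Covariance of `φ` under `γ⁻¹`, for the test function `conj (β_d(γ) f)`.
  have h1 := h γ⁻¹ (conjFn (Mob.beta d γ f)) v u
  rw [conjFn_conjFn, Mob.beta_inv_conjFn_beta, op_inv, star_star] at h1
  rw [← inner_conj_symm (op U γ (v : H)), h1, inner_conj_symm]
  rfl

/-- If `φ(f) ⊆ X ⊆ φ†(conj f)†` then the adjoint of `X` is defined on the domain of `φ`, where it
agrees with `φ†(conj f)`. -/
theorem AdjDistribution.inner_smear_conjFn {D : Submodule ℂ H} (hD : Dense (D : Set H))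
    {φ : AdjDistribution D} {f : SmoothFn} {X : H →ₗ.[ℂ] H}
    (hX : X ≤ (φ.dagger.unbdd (conjFn f)).adjoint) (v : D) (x : X.domain) :
    inner ℂ (φ.dagger.smear (conjFn f) v) (x : H) = inner ℂ (v : H) (X x) := by
  have h1 : X x = (φ.dagger.unbdd (conjFn f)).adjoint ⟨x, hX.1 x.2⟩ := hX.2 rfl
  have h2 := LinearPMap.adjoint_isFormalAdjoint (T := φ.dagger.unbdd (conjFn f)) hD
    ⟨x, hX.1 x.2⟩ v
  rw [h1, ← inner_conj_symm (v : H)]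
  exact (inner_conj_symm _ _).symm.trans (congrArg conj h2.symm)

theorem IsAffiliated.adjoint {X : H →ₗ.[ℂ] H} {M : VonNeumannAlgebra H} (hX : IsAffiliated X M)
    (hadj : Dense (X.adjoint.domain : Set H)) : IsAffiliated X.adjoint M := by
  refine ⟨hadj, LinearPMap.adjoint_isClosed hX.1, fun T hT y => ?_⟩
  have h1 : ∀ x : X.domain,
      inner ℂ (T (X.adjoint y)) (x : H) = inner ℂ (T (y : H)) (X x) := by
    intro x
    obtain ⟨h2, h3⟩ := hX.2.2 (star T) (star_mem hT) x
    have h4 := LinearPMap.adjoint_isFormalAdjoint hX.1 y ⟨_, h2⟩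
    rw [h3] at h4
    simpa only [ContinuousLinearMap.star_eq_adjoint, ContinuousLinearMap.adjoint_inner_right]
      using h4
  exact ⟨LinearPMap.mem_adjoint_domain_of_exists _ ⟨_, h1⟩, LinearPMap.adjoint_apply_eq hX.1 _ h1⟩

theorem AdjDistribution.IsAffiliatedWithNet.dagger {D : Submodule ℂ H} (hD : Dense (D : Set H))
    {φ : AdjDistribution D} {A : Interval → VonNeumannAlgebra H} (h : φ.IsAffiliatedWithNet A) :
    φ.dagger.IsAffiliatedWithNet A := by
  intro I f hf
  have hf' : tsupport (conjFn f) ⊆ I.carrier := by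
    refine (closure_mono fun z hz => ?_).trans hf
    intro h0
    exact hz (by simp [conjFn, h0])
  obtain ⟨X, h1, h2, h3⟩ := h I (conjFn f) hf'
  have h4 := AdjDistribution.inner_smear_conjFn hD h2
  rw [conjFn_conjFn] at h4
  have h5 : φ.dagger.unbdd f ≤ X.adjoint := by
    refine LinearPMap.IsFormalAdjoint.le_adjoint h3.1 fun x y => ?_
    rw [← inner_conj_symm, ← inner_conj_symm (x : H)]
    exact congrArg conj (h4 y x).symm
  refine ⟨X.adjoint, h5, ?_, h3.adjoint (hD.mono h5.1)⟩
  refine LinearPMap.IsFormalAdjoint.le_adjoint hD fun u y => ?_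
  have h6 := LinearPMap.adjoint_isFormalAdjoint h3.1 y ⟨(u : H), h1.1 u.2⟩
  rw [← h1.2 (x := u) rfl] at h6
  rw [← inner_conj_symm, ← inner_conj_symm (u : H), h6]
  rfl

end Adjoint

/-! ### Localization of test functions -/

/-- The intervals form a neighbourhood basis of the circle. -/
theorem Interval.exists_mem_subset {O : Set Circle} (hO : IsOpen O) {z : Circle} (hz : z ∈ O) :
    ∃ I : Interval, z ∈ I.carrier ∧ I.carrier ⊆ O := by
  obtain ⟨θ, rfl⟩ := Circle.exp_surjective z
  have h1 : Circle.exp ⁻¹' O ∈ 𝓝 θ :=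
    (hO.preimage Circle.exp.continuous).mem_nhds hz
  obtain ⟨r, hr, hrO⟩ := Metric.mem_nhds_iff.1 h1
  -- The arc has length less than `2`, so it misses the point opposite to its centre.
  let s := min r 1
  have hs : 0 < s := lt_min hr one_pos
  have hball : Metric.ball θ s ⊆ Metric.ball θ r := Metric.ball_subset_ball (min_le_left _ _)
  refine ⟨⟨Circle.exp '' Metric.ball θ s,
    isLocalHomeomorph_circleExp.isOpenMap _ Metric.isOpen_ball,
    ⟨⟨_, θ, Metric.mem_ball_self hs, rfl⟩,
      (convex_ball θ s).isPreconnected.image _ Circle.exp.continuous.continuousOn⟩, fun hd => ?_⟩,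
    ⟨θ, Metric.mem_ball_self hs, rfl⟩, ?_⟩
  · have hcl : IsClosed (Circle.exp '' Metric.closedBall θ s) :=
      ((isCompact_closedBall θ s).image Circle.exp.continuous).isClosed
    have h2 : Circle.exp (θ + Real.pi) ∈ Circle.exp '' Metric.closedBall θ s :=
      closure_minimal (Set.image_mono Metric.ball_subset_closedBall) hcl (hd _)
    obtain ⟨t, ht, hte⟩ := h2
    obtain ⟨m, hm⟩ := Circle.exp_eq_exp.1 hte
    rw [Metric.mem_closedBall, Real.dist_eq] at ht
    have h3 : |Real.pi * (1 + 2 * m)| ≤ 1 := by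
      have : t - θ = Real.pi * (1 + 2 * m) := by rw [hm]; ring
      rw [← this]
      exact ht.trans (min_le_right _ _)
    rw [abs_mul, abs_of_pos Real.pi_pos] at h3
    have h4 : (1 : ℝ) ≤ |1 + 2 * (m : ℝ)| := by
      have : (1 : ℤ) ≤ |1 + 2 * m| := Int.one_le_abs (by omega)
      exact_mod_cast this
    nlinarith [Real.pi_gt_three]
  · rintro _ ⟨t, ht, rfl⟩
    exact hrO (hball ht)

/-- A test function supported in an open set is a sum of test functions supported in intervals
contained in that set. -/
theorem SmoothFn.exists_eq_sum {O : Set Circle} (hO : IsOpen O) (f : SmoothFn)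
    (hf : tsupport f ⊆ O) :
    ∃ (s : Finset {I : Interval // I.carrier ⊆ O}) (F : {I : Interval // I.carrier ⊆ O} → SmoothFn),
      f = ∑ i ∈ s, F i ∧ ∀ i, tsupport (F i) ⊆ i.1.carrier := by
  have := finrank_real_complex_fact'
  have hcover : tsupport f ⊆ ⋃ i : {I : Interval // I.carrier ⊆ O}, i.1.carrier := by
    intro z hz
    obtain ⟨I, h1, h2⟩ := Interval.exists_mem_subset hO (hf hz)
    exact Set.mem_iUnion.2 ⟨⟨I, h2⟩, h1⟩
  obtain ⟨ρ, hρ⟩ := SmoothPartitionOfUnity.exists_isSubordinate (𝓡 1) (isClosed_tsupport f.1)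
    (fun i : {I : Interval // I.carrier ⊆ O} => i.1.carrier) (fun i => i.1.isOpen) hcover
  have hfin : {i | (Function.support (ρ i)).Nonempty}.Finite :=
    ρ.locallyFinite.finite_nonempty_of_compact
  let F : {I : Interval // I.carrier ⊆ O} → SmoothFn := fun i =>
    ⟨fun z => ρ i z • f z, (ρ i).contMDiff.smul f.2⟩
  refine ⟨hfin.toFinset, F, Subtype.ext (funext fun z => ?_), fun i => ?_⟩
  · have h1 : (∑ i ∈ hfin.toFinset, F i).1 z = ∑ i ∈ hfin.toFinset, ρ i z • f z := by
      rw [AddSubmonoidClass.coe_finsetSum, Finset.sum_apply]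
    rw [h1, ← Finset.sum_smul]
    by_cases hz : z ∈ tsupport f.1
    · have h2 : ∑ i ∈ hfin.toFinset, ρ i z = 1 := by
        rw [← ρ.sum_eq_one hz, finsum_eq_sum_of_support_subset]
        intro i hi
        exact hfin.mem_toFinset.2 ⟨z, hi⟩
      rw [h2, one_smul]
    · rw [image_eq_zero_of_notMem_tsupport hz, smul_zero]
  · exact (closure_mono (Function.support_smul_subset_left _ _)).trans (hρ i)

/-! ### Locality -/

section Locality

variable {H : Type*} [NormedAddCommGroup H] [InnerProductSpace ℂ H]

theorem AdjDistribution.extend_sum {D : Submodule ℂ H} (φ : AdjDistribution D) {ι : Type*}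
    (s : Finset ι) (F : ι → SmoothFn) (ξ : H) :
    φ.extend (∑ i ∈ s, F i) ξ = ∑ i ∈ s, φ.extend (F i) ξ := by
  have hadd : ∀ f g, φ.extend (f + g) ξ = φ.extend f ξ + φ.extend g ξ := by
    intro f g
    have h : conjFn (f + g) = conjFn f + conjFn g :=
      Subtype.ext (funext fun z => map_add conj (f z) (g z))
    refine LinearMap.ext fun v => ?_
    change inner ℂ (φ.dagger.smear (conjFn (f + g)) v) ξ =
      inner ℂ (φ.dagger.smear (conjFn f) v) ξ + inner ℂ (φ.dagger.smear (conjFn g) v) ξ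
    rw [h, ← inner_add_left, AdjDistribution.smear, map_add, LinearMap.add_apply]
  exact map_sum (AddMonoidHom.mk' (fun f => φ.extend f ξ) hadd) F s

theorem AdjDistribution.extend_sum_right {D : Submodule ℂ H} (φ : AdjDistribution D)
    (f : SmoothFn) {ι : Type*} (s : Finset ι) (w : ι → H) :
    φ.extend f (∑ i ∈ s, w i) = ∑ i ∈ s, φ.extend f (w i) := by
  refine LinearMap.ext fun v => ?_
  rw [LinearMap.sum_apply]
  exact inner_sum (𝕜 := ℂ) s w (φ.dagger.smear (conjFn f) v)

variable [CompleteSpace H]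

/-- Locality for test functions supported in disjoint intervals. Let `X` and `Y` be extensions of
`φ(f)` and `ψ(g)` affiliated with `A(I)` and `A(J)`. The bounded approximations of `X` in `A(I)`
commute with `Y`, and in the limit `⟨X† v, Y u⟩ = ⟨Y† v, X u⟩`. -/
theorem AdjDistribution.extend_smear_comm_of_disjoint {D : Submodule ℂ H} (hD : Dense (D : Set H))
    {A : Interval → VonNeumannAlgebra H} {I J : Interval}
    (hloc : ∀ x ∈ A I, ∀ y ∈ A J, x * y = y * x) {φ ψ : AdjDistribution D}
    (hφ : φ.IsAffiliatedWithNet A) (hψ : ψ.IsAffiliatedWithNet A) {f g : SmoothFn}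
    (hf : tsupport f ⊆ I.carrier) (hg : tsupport g ⊆ J.carrier) (u : D) :
    φ.extend f (ψ.smear g u) = ψ.extend g (φ.smear f u) := by
  obtain ⟨X, hX1, hX2, hX3⟩ := hφ I f hf
  obtain ⟨Y, hY1, hY2, hY3⟩ := hψ J g hg
  refine LinearMap.ext fun v => ?_
  change inner ℂ (φ.dagger.smear (conjFn f) v) (ψ.smear g u) =
    inner ℂ (ψ.dagger.smear (conjFn g) v) (φ.smear f u)
  have hXadj := AdjDistribution.inner_smear_conjFn hD hX2
  have hYadj := AdjDistribution.inner_smear_conjFn hD hY2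
  obtain ⟨B, hB, hBX, hBv⟩ := hX3.exists_tendsto (hD.mono fun w hw => ⟨_, hXadj ⟨w, hw⟩⟩)
    ⟨(u : H), hX1.1 u.2⟩ (hXadj v)
  have hXu : φ.smear f u = X ⟨(u : H), hX1.1 u.2⟩ := hX1.2 (x := u) rfl
  have hYu : ψ.smear g u = Y ⟨(u : H), hY1.1 u.2⟩ := hY1.2 (x := u) rfl
  have hcomm : ∀ n, inner ℂ (star (B n) (v : H)) (ψ.smear g u) =
      inner ℂ (ψ.dagger.smear (conjFn g) v) (B n u) := by
    intro n
    have hBn : B n ∈ (A J).commutant :=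
      VonNeumannAlgebra.mem_commutant_iff.2 fun y hy => (hloc _ (hB n) y hy).symm
    obtain ⟨h1, h2⟩ := hY3.2.2 (B n) hBn ⟨(u : H), hY1.1 u.2⟩
    have h3 := hYadj v ⟨_, h1⟩
    rw [ContinuousLinearMap.star_eq_adjoint, ContinuousLinearMap.adjoint_inner_left, hYu, ← h2]
    exact h3.symm
  have h1 := hBv.inner (tendsto_const_nhds (x := ψ.smear g u)) (𝕜 := ℂ)
  have h2 := (tendsto_const_nhds (x := ψ.dagger.smear (conjFn g) v)).inner hBX (𝕜 := ℂ)
  simp only [hcomm] at h1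
  rw [hXu]
  exact tendsto_nhds_unique h1 h2

/-- Locality for disjoint supports: disjoint neighbourhoods of the supports reduce it to test
functions supported in disjoint intervals. -/
theorem AdjDistribution.extend_smear_comm {D : Submodule ℂ H} (hD : Dense (D : Set H))
    {A : Interval → VonNeumannAlgebra H}
    (hloc : ∀ I J : Interval, Disjoint I.carrier J.carrier → ∀ x ∈ A I, ∀ y ∈ A J, x * y = y * x)
    {φ ψ : AdjDistribution D} (hφ : φ.IsAffiliatedWithNet A) (hψ : ψ.IsAffiliatedWithNet A)
    {f g : SmoothFn} (hfg : Disjoint (tsupport f) (tsupport g)) (u : D) :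
    φ.extend f (ψ.smear g u) = ψ.extend g (φ.smear f u) := by
  obtain ⟨O, O', hO, hO', hfO, hgO', hdisj⟩ :=
    normal_separation (isClosed_tsupport f.1) (isClosed_tsupport g.1) hfg
  obtain ⟨s, F, hF, hFs⟩ := SmoothFn.exists_eq_sum hO f hfO
  obtain ⟨s', G, hG, hGs⟩ := SmoothFn.exists_eq_sum hO' g hgO'
  rw [hF, hG, AdjDistribution.extend_sum, AdjDistribution.extend_sum]
  simp only [AdjDistribution.smear, map_sum, LinearMap.sum_apply,
    AdjDistribution.extend_sum_right]
  rw [Finset.sum_comm]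
  exact Finset.sum_congr rfl fun j _ => Finset.sum_congr rfl fun i _ =>
    AdjDistribution.extend_smear_comm_of_disjoint hD
      (hloc i.1 j.1 (hdisj.mono i.2 j.2)) hφ hψ (hFs i) (hGs j) u

end Locality

end

end ChiralCFT

theorem mainTheorem7 {H : Type*} [NormedAddCommGroup H] [InnerProductSpace ℂ H] [CompleteSpace H]
    (A : ChiralCFT.Interval → VonNeumannAlgebra H)
    (U : ChiralCFT.Mob →* unitary (H →L[ℂ] H)) (Ω : H)
    (hA : ChiralCFT.IsMobCovariantNet A U Ω) :
    ChiralCFT.IsQuasiWightmanExceptCyclicity U Ω (ChiralCFT.affiliatedFields A U) := by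
  have hD := ChiralCFT.dense_finiteEnergy hA.sot_continuous hA.spectrum
  exact {
    dense := hD
    sot_continuous := hA.sot_continuous
    mob_covariance := fun φ hφ => hφ.1
    dagger_mem := fun φ hφ => ⟨hφ.1.imp fun _ h => h.dagger, hφ.2.dagger hD⟩
    locality := fun φ hφ ψ hψ f g hfg u =>
      ChiralCFT.AdjDistribution.extend_smear_comm hD hA.locality hφ.2 hψ.2 hfg u
    spectrum := hA.spectrum
    vacuum_mem := ChiralCFT.mem_finiteEnergy_of_rot hA.spectrum (n := 0) fun θ => by
      simpa using hA.vacuum_invariant (ChiralCFT.Mob.rot θ)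
    vacuum_ne_zero := hA.vacuum_ne_zero
    vacuum_invariant := hA.vacuum_invariant
    vacuum_unique := fun ξ _ hξ => hA.vacuum_unique ξ hξ }
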